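/- \textbf{Theorem 1 (Lower bound of the decomposition cost).} Let $X,Y,Z$ be the Pauli matrices. The Cartan coordinate of $U\in SU(4)$ is the triple of real numbers $(k_x,k_y,k_z)$ with $0\le |k_z|\le k_y\le k_x\le \frac{\pi}{4}$, and $k_z\ge 0$ if $k_x=\frac{\pi}{4}$, such that $U = k_g\,(a\otimes b)\,e^{i(k_x X\otimes X+k_y Y\otimes Y+k_z Z\otimes Z)}\,(c\otimes d)$ for some $k_g\in\{1,i\}$ and $a,b,c,d\in SU(2)$ (KAK decomposition). Let $k_t(U)=|k_x|+|k_y|+|k_z|$ be its $L^1$ norm. Let $\theta_x\ge 0$ and $D_a(\theta_x)=e^{i\theta_x X\otimes X}$, and suppose that $U$ is implemented by a two-qubit circuit consisting of exactly $N\ge 0$ gates $D_a(\theta_x)$ together with arbitrary single-qubit gates (elements of $U(2)$ acting on either qubit). If $N\theta_x<\frac{\pi}{4}$, then $$\sin\bigl(k_t(U)\bigr)\le\sin(N\theta_x),$$ and consequently $k_t(U)\le N\theta_x$, which bounds the number $N$ of $D_a(\theta_x)$ gates from below. -/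

import Mathlib

open scoped Kronecker

/-- Operators on two qubits, with respect to the product basis of `ℂ² ⊗ ℂ²`. -/
abbrev TwoQubitOp : Type := Matrix (Fin 2 × Fin 2) (Fin 2 × Fin 2) ℂ

/-- The Pauli matrix `X`. -/
def pauliX : Matrix (Fin 2) (Fin 2) ℂ := !![0, 1; 1, 0]

/-- The Pauli matrix `Y`. -/
def pauliY : Matrix (Fin 2) (Fin 2) ℂ := !![0, -Complex.I; Complex.I, 0]

/-- The Pauli matrix `Z`. -/
def pauliZ : Matrix (Fin 2) (Fin 2) ℂ := !![1, 0; 0, -1]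

/-- The canonical two-qubit gate `exp (i (x X⊗X + y Y⊗Y + z Z⊗Z))`. -/
noncomputable def canonicalGate (x y z : ℝ) : TwoQubitOp :=
  NormedSpace.exp (Complex.I •
    ((x : ℂ) • (pauliX ⊗ₖ pauliX) + (y : ℂ) • (pauliY ⊗ₖ pauliY)
      + (z : ℂ) • (pauliZ ⊗ₖ pauliZ)))

/-- The basis gate `D_a(θ) = exp (i θ X⊗X)`. -/
noncomputable def gateDa (θ : ℝ) : TwoQubitOp :=
  NormedSpace.exp (Complex.I • ((θ : ℂ) • (pauliX ⊗ₖ pauliX)))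

/-- `(x, y, z)` is the Cartan coordinate (from the KAK decomposition) of the two-qubit
operator `U`: it lies in the Weyl chamber, and `U` is the canonical gate with these angles
up to gates of `SU(2) ⊗ SU(2)` on both sides and a phase in `{1, i}`. -/
structure IsCartanCoordinate (U : TwoQubitOp) (x y z : ℝ) : Prop where
  abs_z_le : |z| ≤ y
  y_le : y ≤ x
  x_le : x ≤ Real.pi / 4
  z_nonneg : x = Real.pi / 4 → 0 ≤ z
  decomp : ∃ k : ℂ, (k = 1 ∨ k = Complex.I) ∧
    ∃ a ∈ Matrix.specialUnitaryGroup (Fin 2) ℂ, ∃ b ∈ Matrix.specialUnitaryGroup (Fin 2) ℂ,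
    ∃ c ∈ Matrix.specialUnitaryGroup (Fin 2) ℂ, ∃ d ∈ Matrix.specialUnitaryGroup (Fin 2) ℂ,
      U = k • ((a ⊗ₖ b) * canonicalGate x y z * (c ⊗ₖ d))

/-- `DaCircuit θ N U`: the operator `U` is implemented by a two-qubit circuit that contains
exactly `N` gates `D_a(θ)` and, besides them, only single-qubit gates. A single-qubit gate is
an arbitrary unitary in `U(2)`; an operator `a ⊗ b` is a layer of one such gate on each qubit. -/
inductive DaCircuit (θ : ℝ) : ℕ → TwoQubitOp → Prop
  | empty : DaCircuit θ 0 1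
  | singleQubit {N : ℕ} {V : TwoQubitOp} (a b : Matrix (Fin 2) (Fin 2) ℂ)
      (ha : a ∈ Matrix.unitaryGroup (Fin 2) ℂ) (hb : b ∈ Matrix.unitaryGroup (Fin 2) ℂ)
      (hV : DaCircuit θ N V) : DaCircuit θ N ((a ⊗ₖ b) * V)
  | gate {N : ℕ} {V : TwoQubitOp} (hV : DaCircuit θ N V) : DaCircuit θ (N + 1) (gateDa θ * V)

open Matrix Complex

/-! Write J for the spin flip and call w real if Jw = w. Local SU(2) gates commute with J. For m =
‖w‖, writing ‖w - Jw‖ = 2m sin β measures the angle β between w and the real vectors, and one gate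
raises β by at most θ (`stateNorm_gateDa_sub_spinFlip_le`). So after N gates a real input has angle
at most Nθ (`DaCircuit.exists_specialUnitary`). Conversely, Bell states are real up to a phase and
are eigenvectors of the canonical gate, so each eigenvalue, times a leftover fourth root of unity r,
has imaginary part at most sin(Nθ) in absolute value (`abs_im_mul_exp_bellAngle_le`). If r = ±1, a
suitable Bell state yields sin(k_t); the Weyl chamber excludes r = ±i. -/

/-- The antiunitary spin-flip `w ↦ (Y ⊗ Y) w̄` on two-qubit states. -/
noncomputable def spinFlip (w : Fin 2 × Fin 2 → ℂ) : Fin 2 × Fin 2 → ℂ :=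
  (pauliY ⊗ₖ pauliY) *ᵥ star w

/-- The Hilbert-space norm of a two-qubit state. -/
noncomputable def stateNorm (w : Fin 2 × Fin 2 → ℂ) : ℝ := ‖WithLp.toLp 2 w‖

/-- The matrix whose columns are the (unnormalized) Bell states. -/
def bell : TwoQubitOp :=
  fun i j => if i.1 + i.2 = j.2 then (if j.1 = 1 ∧ i.1 = 1 then -1 else 1) else 0

/-! ### Norms of states -/

theorem stateNorm_smul (z : ℂ) (w : Fin 2 × Fin 2 → ℂ) :
    stateNorm (z • w) = ‖z‖ * stateNorm w := by
  simp [stateNorm, norm_smul]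

theorem stateNorm_add_le (v w : Fin 2 × Fin 2 → ℂ) :
    stateNorm (v + w) ≤ stateNorm v + stateNorm w := by
  simpa [stateNorm] using norm_add_le (WithLp.toLp 2 v) (WithLp.toLp 2 w)

theorem stateNorm_nonneg (w : Fin 2 × Fin 2 → ℂ) : 0 ≤ stateNorm w := norm_nonneg _

theorem stateNorm_pos {w : Fin 2 × Fin 2 → ℂ} (hw : w ≠ 0) : 0 < stateNorm w := by
  simpa [stateNorm] using hw

theorem stateNorm_parallelogram (v w : Fin 2 × Fin 2 → ℂ) :
    stateNorm (v - w) ^ 2 + stateNorm (v + w) ^ 2 = 2 * (stateNorm v ^ 2 + stateNorm w ^ 2) := by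
  have := parallelogram_law_with_norm ℂ (WithLp.toLp 2 v) (WithLp.toLp 2 w)
  simp only [stateNorm, WithLp.toLp_sub, WithLp.toLp_add]
  nlinarith

theorem stateNorm_sq (w : Fin 2 × Fin 2 → ℂ) : ((stateNorm w ^ 2 : ℝ) : ℂ) = star w ⬝ᵥ w := by
  rw [stateNorm, EuclideanSpace.norm_sq_eq]
  simp [dotProduct, Complex.conj_mul']

theorem stateNorm_star (w : Fin 2 × Fin 2 → ℂ) : stateNorm (star w) = stateNorm w := by
  simp [stateNorm, EuclideanSpace.norm_eq]

theorem stateNorm_unitary_mulVec {V : TwoQubitOp} (hV : V ∈ unitaryGroup (Fin 2 × Fin 2) ℂ)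
    (w : Fin 2 × Fin 2 → ℂ) : stateNorm (V *ᵥ w) = stateNorm w := by
  have h : stateNorm (V *ᵥ w) ^ 2 = stateNorm w ^ 2 := by
    apply Complex.ofReal_injective
    rw [stateNorm_sq, stateNorm_sq, star_mulVec, ← dotProduct_mulVec, mulVec_mulVec,
      ← star_eq_conjTranspose, mem_unitaryGroup_iff'.1 hV, one_mulVec]
  exact (sq_eq_sq₀ (stateNorm_nonneg _) (stateNorm_nonneg _)).1 h

/-! ### Spin flip and local gates -/

theorem pauliX_mem : pauliX ∈ unitaryGroup (Fin 2) ℂ := by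
  rw [mem_unitaryGroup_iff]
  ext i j
  fin_cases i <;> fin_cases j <;> simp [pauliX, Matrix.mul_apply, star_apply]

theorem pauliY_mem : pauliY ∈ unitaryGroup (Fin 2) ℂ := by
  rw [mem_unitaryGroup_iff]
  ext i j
  fin_cases i <;> fin_cases j <;> simp [pauliY, Matrix.mul_apply, star_apply]

theorem kronecker_self_mem_unitary {a b : Matrix (Fin 2) (Fin 2) ℂ}
    (ha : a ∈ unitaryGroup (Fin 2) ℂ) (hb : b ∈ unitaryGroup (Fin 2) ℂ) :
    a ⊗ₖ b ∈ unitaryGroup (Fin 2 × Fin 2) ℂ :=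
  kronecker_mem_unitary ha hb

theorem stateNorm_spinFlip (w : Fin 2 × Fin 2 → ℂ) : stateNorm (spinFlip w) = stateNorm w := by
  rw [spinFlip, stateNorm_unitary_mulVec (kronecker_self_mem_unitary pauliY_mem pauliY_mem),
    stateNorm_star]

theorem spinFlip_add (v w : Fin 2 × Fin 2 → ℂ) :
    spinFlip (v + w) = spinFlip v + spinFlip w := by
  simp [spinFlip, mulVec_add]

theorem spinFlip_smul (z : ℂ) (w : Fin 2 × Fin 2 → ℂ) :
    spinFlip (z • w) = star z • spinFlip w := by
  simp [spinFlip, mulVec_smul]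

theorem star_mulVec_eq_map (M : TwoQubitOp) (w : Fin 2 × Fin 2 → ℂ) :
    star (M *ᵥ w) = M.map star *ᵥ star w := by
  ext i
  simp [mulVec, dotProduct]

/-- Pseudoreality of SU(2): the inverse is both the adjoint and the adjugate, so entrywise
conjugation is conjugation by Y. -/
theorem pauliY_mul_map_star {a : Matrix (Fin 2) (Fin 2) ℂ}
    (ha : a ∈ specialUnitaryGroup (Fin 2) ℂ) : pauliY * a.map star = a * pauliY := by
  obtain ⟨hu, hd⟩ := mem_specialUnitaryGroup_iff.1 ha
  have h : star a = adjugate a := by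
    have h1 := mem_unitaryGroup_iff'.1 hu
    calc star a = star a * (a * adjugate a) := by rw [mul_adjugate, hd, one_smul, mul_one]
      _ = adjugate a := by rw [← mul_assoc, h1, one_mul]
  rw [adjugate_fin_two] at h
  have e : ∀ i j, star (a j i) = !![a 1 1, -a 0 1; -a 1 0, a 0 0] i j := fun i j => by
    rw [← h, star_apply]
  have h00 := e 0 0
  have h01 := e 0 1
  have h10 := e 1 0
  have h11 := e 1 1
  simp at h00 h01 h10 h11
  ext i j
  fin_cases i <;> fin_cases j <;> simp [pauliY, Matrix.mul_apply, h00, h01, h10, h11, mul_comm]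

theorem spinFlip_kronecker_mulVec {a b : Matrix (Fin 2) (Fin 2) ℂ}
    (ha : a ∈ specialUnitaryGroup (Fin 2) ℂ) (hb : b ∈ specialUnitaryGroup (Fin 2) ℂ)
    (w : Fin 2 × Fin 2 → ℂ) : spinFlip ((a ⊗ₖ b) *ᵥ w) = (a ⊗ₖ b) *ᵥ spinFlip w := by
  have hm : (a ⊗ₖ b).map star = a.map star ⊗ₖ b.map star := by
    ext i j
    simp [kroneckerMap_apply]
  rw [spinFlip, spinFlip, star_mulVec_eq_map, mulVec_mulVec, mulVec_mulVec, hm,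
    ← mul_kronecker_mul, ← mul_kronecker_mul, pauliY_mul_map_star ha, pauliY_mul_map_star hb]

/-- X is real and anticommutes with Y; the signs from the two factors cancel. -/
theorem spinFlip_pauliXX_mulVec (w : Fin 2 × Fin 2 → ℂ) :
    spinFlip ((pauliX ⊗ₖ pauliX) *ᵥ w) = (pauliX ⊗ₖ pauliX) *ᵥ spinFlip w := by
  have hm : (pauliX ⊗ₖ pauliX).map star = pauliX ⊗ₖ pauliX := by
    ext ⟨i, i'⟩ ⟨j, j'⟩
    fin_cases i <;> fin_cases i' <;> fin_cases j <;> fin_cases j' <;> simp [pauliX]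
  have hc : pauliY * pauliX = -(pauliX * pauliY) := by
    ext i j
    fin_cases i <;> fin_cases j <;> simp [pauliX, pauliY]
  rw [spinFlip, spinFlip, star_mulVec_eq_map, mulVec_mulVec, mulVec_mulVec, hm,
    ← mul_kronecker_mul, ← mul_kronecker_mul, hc]
  congr 1
  ext i j
  simp [kroneckerMap_apply]

theorem exists_smul_specialUnitary {a : Matrix (Fin 2) (Fin 2) ℂ}
    (ha : a ∈ unitaryGroup (Fin 2) ℂ) :
    ∃ q : ℂ, ∃ a' ∈ specialUnitaryGroup (Fin 2) ℂ, a = q • a' := by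
  obtain ⟨q, hq⟩ := IsAlgClosed.exists_pow_nat_eq a.det (n := 2) (by norm_num)
  have hd : ‖a.det‖ = 1 := by
    have h := (mem_unitaryGroup_iff.1 ha)
    have h2 := congrArg Matrix.det h
    rw [det_mul, star_eq_conjTranspose, det_conjTranspose, det_one] at h2
    have h3 := congrArg norm h2
    rw [norm_mul, norm_star, norm_one] at h3
    nlinarith [norm_nonneg a.det]
  have hq1 : ‖q‖ = 1 := by
    rw [← hq, norm_pow] at hd
    exact (pow_eq_one_iff_of_nonneg (norm_nonneg _) two_ne_zero).1 hd
  have hq0 : q ≠ 0 := norm_ne_zero_iff.1 (by rw [hq1]; exact one_ne_zero)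
  refine ⟨q, q⁻¹ • a, mem_specialUnitaryGroup_iff.2 ⟨?_, ?_⟩, by rw [smul_inv_smul₀ hq0]⟩
  · have hs : q⁻¹ * star q⁻¹ = 1 := by
      rw [Complex.star_def, Complex.mul_conj']
      simp [hq1]
    rw [mem_unitaryGroup_iff, star_smul, smul_mul_smul_comm, mem_unitaryGroup_iff.1 ha, hs,
      one_smul]
  · rw [det_smul, Fintype.card_fin, inv_pow, hq, inv_mul_cancel₀]
    exact norm_ne_zero_iff.1 (by rw [hd]; exact one_ne_zero)

/-! ### Diagonalisation in the Bell basis -/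

/-- The eigenvalue exponents of the canonical gate on the Bell states. -/
def bellAngle (x y z : ℝ) (j : Fin 2 × Fin 2) : ℝ :=
  (if j.1 = 0 then x else -x) + (if j.1 = j.2 then -y else y) + (if j.2 = 0 then z else -z)

theorem isUnit_bell : IsUnit bell := by
  -- The columns are real, orthogonal and of squared norm 2.
  refine IsUnit.of_mul_eq_one ((2⁻¹ : ℂ) • bellᵀ) ?_
  ext ⟨i, i'⟩ ⟨j, j'⟩
  fin_cases i <;> fin_cases i' <;> fin_cases j <;> fin_cases j' <;>
    simp [bell, Matrix.mul_apply, Fintype.sum_prod_type] <;> norm_num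

theorem generator_mul_bell (x y z : ℝ) :
    (I • ((x : ℂ) • (pauliX ⊗ₖ pauliX) + (y : ℂ) • (pauliY ⊗ₖ pauliY)
      + (z : ℂ) • (pauliZ ⊗ₖ pauliZ))) * bell
      = bell * diagonal fun j => I * (bellAngle x y z j : ℂ) := by
  ext ⟨i, i'⟩ ⟨j, j'⟩
  rw [mul_diagonal]
  fin_cases i <;> fin_cases i' <;> fin_cases j <;> fin_cases j' <;>
    simp [bell, bellAngle, Matrix.mul_apply, Fintype.sum_prod_type, kroneckerMap_apply, pauliX,
      pauliY, pauliZ] <;> ring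

theorem canonicalGate_mul_bell (x y z : ℝ) :
    canonicalGate x y z * bell
      = bell * diagonal fun j => Complex.exp (I * (bellAngle x y z j : ℂ)) := by
  have hd : IsUnit bell.det := (isUnit_iff_isUnit_det _).1 isUnit_bell
  have h : (I • ((x : ℂ) • (pauliX ⊗ₖ pauliX) + (y : ℂ) • (pauliY ⊗ₖ pauliY)
      + (z : ℂ) • (pauliZ ⊗ₖ pauliZ)))
      = bell * (diagonal fun j => I * (bellAngle x y z j : ℂ)) * bell⁻¹ := by
    rw [← generator_mul_bell, mul_nonsing_inv_cancel_right _ _ hd]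
  have he : NormedSpace.exp (fun j => I * (bellAngle x y z j : ℂ))
      = fun j => Complex.exp (I * (bellAngle x y z j : ℂ)) := by
    ext j
    rw [Pi.coe_exp, Complex.exp_eq_exp_ℂ]
  rw [canonicalGate, h, Matrix.exp_conj _ _ isUnit_bell, nonsing_inv_mul_cancel_right _ _ hd,
    Matrix.exp_diagonal, he]

theorem det_canonicalGate (x y z : ℝ) : (canonicalGate x y z).det = 1 := by
  have hd : bell.det ≠ 0 := ((isUnit_iff_isUnit_det _).1 isUnit_bell).ne_zero
  have h := congrArg det (canonicalGate_mul_bell x y z)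
  rw [det_mul, det_mul, mul_comm, det_diagonal, ← Complex.exp_sum] at h
  have hs : ∑ j, I * (bellAngle x y z j : ℂ) = 0 := by
    simp [Fintype.sum_prod_type, bellAngle]
    ring
  rw [hs, Complex.exp_zero] at h
  exact mul_left_cancel₀ hd h

theorem canonicalGate_mulVec_bell (x y z : ℝ) (j : Fin 2 × Fin 2) :
    canonicalGate x y z *ᵥ bell.col j
      = Complex.exp (I * (bellAngle x y z j : ℂ)) • bell.col j := by
  ext i
  have h := congrFun (congrFun (canonicalGate_mul_bell x y z) i) j
  rw [mul_diagonal, Matrix.mul_apply] at h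
  simpa [mulVec, dotProduct, mul_comm] using h

theorem bell_col_ne_zero (j : Fin 2 × Fin 2) : bell.col j ≠ 0 := by
  intro h
  have h1 := congrFun h (0, j.2)
  simp [bell] at h1

theorem spinFlip_bell_col (j : Fin 2 × Fin 2) :
    spinFlip (bell.col j) = bell.col j ∨ spinFlip (bell.col j) = -bell.col j := by
  obtain ⟨j, j'⟩ := j
  have key : ∀ ε : ℂ, (∀ i i', spinFlip (bell.col (j, j')) (i, i') = ε * bell (i, i') (j, j')) →
      spinFlip (bell.col (j, j')) = ε • bell.col (j, j') := fun ε h => by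
    ext ⟨i, i'⟩
    simp [h]
  fin_cases j <;> fin_cases j'
  · right
    simpa using key (-1) (fun i i' => by
      fin_cases i <;> fin_cases i' <;>
        simp [spinFlip, bell, mulVec, dotProduct, pauliY, Fintype.sum_prod_type])
  · left
    simpa using key 1 (fun i i' => by
      fin_cases i <;> fin_cases i' <;>
        simp [spinFlip, bell, mulVec, dotProduct, pauliY, Fintype.sum_prod_type])
  · left
    simpa using key 1 (fun i i' => by
      fin_cases i <;> fin_cases i' <;>
        simp [spinFlip, bell, mulVec, dotProduct, pauliY, Fintype.sum_prod_type])
  · right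
    simpa using key (-1) (fun i i' => by
      fin_cases i <;> fin_cases i' <;>
        simp [spinFlip, bell, mulVec, dotProduct, pauliY, Fintype.sum_prod_type])

/-! ### One gate and the angle to the real vectors -/

theorem gateDa_eq_canonicalGate (θ : ℝ) : gateDa θ = canonicalGate θ 0 0 := by
  simp [gateDa, canonicalGate]

theorem pauliXX_mul_bell : (pauliX ⊗ₖ pauliX) * bell
    = bell * diagonal fun j => if j.1 = 0 then 1 else -1 := by
  ext ⟨i, i'⟩ ⟨j, j'⟩
  rw [mul_diagonal]
  fin_cases i <;> fin_cases i' <;> fin_cases j <;> fin_cases j' <;>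
    simp [bell, Matrix.mul_apply, Fintype.sum_prod_type, kroneckerMap_apply, pauliX]

theorem gateDa_eq_cos_add_sin (θ : ℝ) :
    gateDa θ = (Real.cos θ : ℂ) • 1 + (I * Real.sin θ) • (pauliX ⊗ₖ pauliX) := by
  rw [← isUnit_bell.mul_left_inj, gateDa_eq_canonicalGate, canonicalGate_mul_bell, add_mul,
    smul_mul_assoc, smul_mul_assoc, pauliXX_mul_bell, one_mul]
  ext i j
  rw [Matrix.add_apply, Matrix.smul_apply, Matrix.smul_apply, mul_diagonal, mul_diagonal]
  by_cases h : j.1 = 0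
  · simp [bellAngle, h, mul_comm I (θ : ℂ), Complex.exp_mul_I]
    ring
  · simp only [bellAngle, h, if_false, ite_self, neg_zero, add_zero, ofReal_neg, mul_comm I,
      Complex.exp_mul_I, Complex.cos_neg, Complex.sin_neg, smul_eq_mul, ofReal_cos, ofReal_sin]
    ring

theorem gateDa_mem_unitaryGroup (θ : ℝ) : gateDa θ ∈ unitaryGroup (Fin 2 × Fin 2) ℂ := by
  have hX : star pauliX = pauliX := by
    ext i j
    fin_cases i <;> fin_cases j <;> simp [pauliX, star_apply]
  have hXX : star (pauliX ⊗ₖ pauliX) = pauliX ⊗ₖ pauliX := by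
    rw [star_eq_conjTranspose, conjTranspose_kronecker, ← star_eq_conjTranspose, hX]
  have hsq : (pauliX ⊗ₖ pauliX) * (pauliX ⊗ₖ pauliX) = 1 := by
    have := mem_unitaryGroup_iff.1 (kronecker_self_mem_unitary pauliX_mem pauliX_mem)
    rwa [hXX] at this
  rw [mem_unitaryGroup_iff, gateDa_eq_cos_add_sin, star_add, star_smul, star_smul, hXX, star_one,
    add_mul, mul_add, mul_add]
  simp only [smul_mul_smul_comm, one_mul, mul_one, hsq, star_mul', Complex.star_def,
    Complex.conj_ofReal, Complex.conj_I]
  have h : (Real.cos θ : ℂ) * Real.cos θ + I * Real.sin θ * (-I * Real.sin θ) = 1 := by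
    have h1 : (Real.cos θ : ℂ) ^ 2 + (Real.sin θ : ℂ) ^ 2 = 1 := by
      exact_mod_cast Real.cos_sq_add_sin_sq θ
    linear_combination h1 - (Real.sin θ : ℂ) ^ 2 * I_mul_I
  have h' : (Real.cos θ : ℂ) * (-I * Real.sin θ) = -(I * Real.sin θ * Real.cos θ) := by ring
  rw [h', neg_smul]
  calc _ = ((Real.cos θ : ℂ) * Real.cos θ + I * Real.sin θ * (-I * Real.sin θ)) •
        (1 : TwoQubitOp) := by rw [add_smul]; abel
    _ = 1 := by rw [h, one_smul]

/-- Antilinearity conjugates the coefficient i sin θ, which turns a difference into a sum in the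
second term. -/
theorem spinFlip_gateDa_mulVec (θ : ℝ) (w : Fin 2 × Fin 2 → ℂ) :
    gateDa θ *ᵥ w - spinFlip (gateDa θ *ᵥ w)
      = (Real.cos θ : ℂ) • (w - spinFlip w)
        + (I * Real.sin θ) • ((pauliX ⊗ₖ pauliX) *ᵥ (w + spinFlip w)) := by
  rw [gateDa_eq_cos_add_sin, add_mulVec, smul_mulVec, smul_mulVec, one_mulVec, spinFlip_add,
    spinFlip_smul, spinFlip_smul, spinFlip_pauliXX_mulVec, mulVec_add]
  have h : star (I * (Real.sin θ : ℂ)) = -(I * Real.sin θ) := by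
    rw [Complex.star_def, map_mul, conj_I, conj_ofReal, neg_mul]
  have h' : star (Real.cos θ : ℂ) = Real.cos θ := conj_ofReal _
  rw [h, h', smul_sub, smul_add, neg_smul]
  abel

/-- With x = m sin β and y = m cos β the left side is m sin(β + θ), and β ≤ α. -/
theorem cos_mul_add_sin_mul_le {m x y α θ : ℝ} (hm : 0 ≤ m) (hx : 0 ≤ x) (hy : 0 ≤ y)
    (hxy : x ^ 2 + y ^ 2 = m ^ 2) (hθ : 0 ≤ θ) (hα : 0 ≤ α) (hαθ : α + θ ≤ Real.pi / 2)
    (h : x ≤ m * Real.sin α) :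
    Real.cos θ * x + Real.sin θ * y ≤ m * Real.sin (α + θ) := by
  rcases hm.eq_or_lt with rfl | hm
  · have hx0 : x = 0 := by nlinarith
    have hy0 : y = 0 := by nlinarith
    simp [hx0, hy0]
  have hxm : x / m ≤ Real.sin α := by rwa [div_le_iff₀' hm]
  have hβ : Real.arcsin (x / m) ≤ α := by
    rw [← Real.arcsin_sin (x := α) (by linarith) (by linarith)]
    exact Real.monotone_arcsin hxm
  have hβ0 : 0 ≤ Real.arcsin (x / m) := Real.arcsin_nonneg.2 (div_nonneg hx hm.le)
  have hs : Real.sin (Real.arcsin (x / m)) = x / m :=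
    Real.sin_arcsin (by linarith [div_nonneg hx hm.le]) (hxm.trans (Real.sin_le_one _))
  have hc : Real.cos (Real.arcsin (x / m)) = y / m := by
    rw [Real.cos_arcsin]
    have : 1 - (x / m) ^ 2 = (y / m) ^ 2 := by
      field_simp
      linarith
    rw [this, Real.sqrt_sq (div_nonneg hy hm.le)]
  have hmono : Real.sin (Real.arcsin (x / m) + θ) ≤ Real.sin (α + θ) :=
    Real.sin_le_sin_of_le_of_le_pi_div_two (by linarith [Real.pi_pos]) hαθ (by linarith)
  rw [Real.sin_add, hs, hc] at hmono
  calc Real.cos θ * x + Real.sin θ * y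
      = m * (x / m * Real.cos θ + y / m * Real.sin θ) := by field_simp
    _ ≤ _ := mul_le_mul_of_nonneg_left hmono hm.le

theorem stateNorm_gateDa_sub_spinFlip_le {w : Fin 2 × Fin 2 → ℂ} {m α θ : ℝ}
    (hw : stateNorm w = m) (hθ : 0 ≤ θ) (hα : 0 ≤ α) (hαθ : α + θ ≤ Real.pi / 2)
    (h : stateNorm (w - spinFlip w) ≤ 2 * m * Real.sin α) :
    stateNorm (gateDa θ *ᵥ w - spinFlip (gateDa θ *ᵥ w)) ≤ 2 * m * Real.sin (α + θ) := by
  have hm : 0 ≤ m := hw ▸ stateNorm_nonneg w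
  have hc : 0 ≤ Real.cos θ :=
    Real.cos_nonneg_of_neg_pi_div_two_le_of_le (by linarith [Real.pi_pos]) (by linarith)
  have hs : 0 ≤ Real.sin θ := Real.sin_nonneg_of_nonneg_of_le_pi hθ (by linarith [Real.pi_pos])
  -- As J preserves norms, ‖w - Jw‖² + ‖w + Jw‖² = (2m)².
  have hp := stateNorm_parallelogram w (spinFlip w)
  rw [stateNorm_spinFlip, hw] at hp
  rw [spinFlip_gateDa_mulVec]
  refine (stateNorm_add_le _ _).trans ?_
  rw [stateNorm_smul, stateNorm_smul,
    stateNorm_unitary_mulVec (kronecker_self_mem_unitary pauliX_mem pauliX_mem), norm_mul, norm_I,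
    one_mul, Complex.norm_real, Complex.norm_real, Real.norm_of_nonneg hc, Real.norm_of_nonneg hs]
  exact cos_mul_add_sin_mul_le (by linarith) (stateNorm_nonneg _) (stateNorm_nonneg _)
    (by linarith) hθ hα hαθ h

/-! ### Induction over circuits -/

theorem det_kronecker_eq_one {a b : Matrix (Fin 2) (Fin 2) ℂ}
    (ha : a ∈ specialUnitaryGroup (Fin 2) ℂ) (hb : b ∈ specialUnitaryGroup (Fin 2) ℂ) :
    (a ⊗ₖ b).det = 1 := by
  simp [det_kronecker, (mem_specialUnitaryGroup_iff.1 ha).2, (mem_specialUnitaryGroup_iff.1 hb).2]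

/-- The distance to the spin flip is not phase invariant, so the phases of the U(2) gates are
collected in p; det V = 1 later forces p⁴ = 1 for U in SU(4). -/
theorem DaCircuit.exists_specialUnitary {θ : ℝ} (hθ : 0 ≤ θ) {N : ℕ} {U : TwoQubitOp}
    (h : DaCircuit θ N U) :
    ∃ p : ℂ, ∃ V ∈ specialUnitaryGroup (Fin 2 × Fin 2) ℂ, U = p • V ∧
      ((N : ℝ) * θ ≤ Real.pi / 2 → ∀ w, spinFlip w = w →
        stateNorm (V *ᵥ w - spinFlip (V *ᵥ w)) ≤ 2 * stateNorm w * Real.sin ((N : ℝ) * θ)) := by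
  induction h with
  | empty =>
    refine ⟨1, 1, one_mem _, by simp, fun _ w hw => ?_⟩
    simp [hw, stateNorm]
  | @singleQubit N V a b ha hb hV ih =>
    obtain ⟨p, V', hV', rfl, hb'⟩ := ih
    obtain ⟨q, a', ha', rfl⟩ := exists_smul_specialUnitary ha
    obtain ⟨r, b', hb'', rfl⟩ := exists_smul_specialUnitary hb
    have hu := kronecker_self_mem_unitary (mem_specialUnitaryGroup_iff.1 ha').1
      (mem_specialUnitaryGroup_iff.1 hb'').1
    refine ⟨q * r * p, (a' ⊗ₖ b') * V',
      mul_mem (mem_specialUnitaryGroup_iff.2 ⟨hu, det_kronecker_eq_one ha' hb''⟩) hV', ?_,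
      fun hN w hw => ?_⟩
    · rw [smul_kronecker, kronecker_smul, smul_smul, smul_mul_smul_comm]
    · rw [← mulVec_mulVec, spinFlip_kronecker_mulVec ha' hb'', ← mulVec_sub,
        stateNorm_unitary_mulVec hu]
      exact hb' hN w hw
  | @gate N V hV ih =>
    obtain ⟨p, V', hV', rfl, hb'⟩ := ih
    have hd : gateDa θ ∈ specialUnitaryGroup (Fin 2 × Fin 2) ℂ :=
      mem_specialUnitaryGroup_iff.2 ⟨gateDa_mem_unitaryGroup θ, by
        rw [gateDa_eq_canonicalGate, det_canonicalGate]⟩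
    refine ⟨p, gateDa θ * V', mul_mem hd hV', by rw [mul_smul_comm], fun hN w hw => ?_⟩
    have hN' : ((N + 1 : ℕ) : ℝ) * θ = N * θ + θ := by push_cast; ring
    rw [hN'] at hN ⊢
    rw [← mulVec_mulVec]
    exact stateNorm_gateDa_sub_spinFlip_le
      (stateNorm_unitary_mulVec (mem_specialUnitaryGroup_iff.1 hV').1 w) hθ (by positivity) hN
      (hb' (by linarith) w hw)

/-! ### Comparison with the Cartan decomposition -/

theorem star_mem_specialUnitaryGroup {a : Matrix (Fin 2) (Fin 2) ℂ}
    (ha : a ∈ specialUnitaryGroup (Fin 2) ℂ) : star a ∈ specialUnitaryGroup (Fin 2) ℂ := by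
  obtain ⟨hu, hd⟩ := mem_specialUnitaryGroup_iff.1 ha
  refine mem_specialUnitaryGroup_iff.2 ⟨Unitary.star_mem hu, ?_⟩
  rw [star_eq_conjTranspose, det_conjTranspose, hd, star_one]

theorem abs_im_mul_exp_bellAngle_le {V : TwoQubitOp} {x y z t : ℝ} {r : ℂ}
    {a b c d : Matrix (Fin 2) (Fin 2) ℂ}
    (ha : a ∈ specialUnitaryGroup (Fin 2) ℂ) (hb : b ∈ specialUnitaryGroup (Fin 2) ℂ)
    (hc : c ∈ specialUnitaryGroup (Fin 2) ℂ) (hd : d ∈ specialUnitaryGroup (Fin 2) ℂ)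
    (hV : V = r • ((a ⊗ₖ b) * canonicalGate x y z * (c ⊗ₖ d)))
    (h : ∀ w, spinFlip w = w →
      stateNorm (V *ᵥ w - spinFlip (V *ᵥ w)) ≤ 2 * stateNorm w * t) (j : Fin 2 × Fin 2) :
    |(r * Complex.exp (I * (bellAngle x y z j : ℂ))).im| ≤ t := by
  -- A Bell state with J-eigenvalue -1 becomes real after multiplication by i.
  obtain ⟨s, e, hs, he, hpos⟩ : ∃ s : ℂ, ∃ e : Fin 2 × Fin 2 → ℂ, e = s • bell.col j ∧
      spinFlip e = e ∧ 0 < stateNorm e := by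
    rcases spinFlip_bell_col j with hj | hj
    · exact ⟨1, bell.col j, by simp, hj, stateNorm_pos (bell_col_ne_zero j)⟩
    · refine ⟨I, I • bell.col j, rfl, by simp [spinFlip_smul, hj], stateNorm_pos ?_⟩
      exact smul_ne_zero I_ne_zero (bell_col_ne_zero j)
  have huab := kronecker_self_mem_unitary (mem_specialUnitaryGroup_iff.1 ha).1
    (mem_specialUnitaryGroup_iff.1 hb).1
  have hc' := star_mem_specialUnitaryGroup hc
  have hd' := star_mem_specialUnitaryGroup hd
  have hu' := kronecker_self_mem_unitary (mem_specialUnitaryGroup_iff.1 hc').1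
    (mem_specialUnitaryGroup_iff.1 hd').1
  -- This real input is carried by c ⊗ d to the Bell vector e.
  have hw := h ((star c ⊗ₖ star d) *ᵥ e) (by rw [spinFlip_kronecker_mulVec hc' hd', he])
  have hcan : canonicalGate x y z *ᵥ e = Complex.exp (I * (bellAngle x y z j : ℂ)) • e := by
    rw [hs, mulVec_smul, canonicalGate_mulVec_bell, smul_comm]
  have hcancel : (c ⊗ₖ d) * (star c ⊗ₖ star d) = 1 := by
    rw [← mul_kronecker_mul, mem_unitaryGroup_iff.1 (mem_specialUnitaryGroup_iff.1 hc).1,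
      mem_unitaryGroup_iff.1 (mem_specialUnitaryGroup_iff.1 hd).1, one_kronecker_one]
  set μ := r * Complex.exp (I * (bellAngle x y z j : ℂ)) with hμ
  have hVw : V *ᵥ ((star c ⊗ₖ star d) *ᵥ e) = μ • ((a ⊗ₖ b) *ᵥ e) := by
    rw [hV, mulVec_mulVec, smul_mul_assoc, mul_assoc, hcancel, mul_one, smul_mulVec,
      ← mulVec_mulVec, hcan, mulVec_smul, smul_smul]
  rw [hVw, spinFlip_smul, spinFlip_kronecker_mulVec ha hb, he, ← sub_smul, stateNorm_smul,
    stateNorm_unitary_mulVec huab, stateNorm_unitary_mulVec hu', Complex.star_def,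
    Complex.sub_conj] at hw
  rw [norm_mul, norm_I, mul_one, Complex.norm_real, Real.norm_eq_abs, abs_mul,
    abs_of_pos (two_pos : (0 : ℝ) < 2)] at hw
  nlinarith

theorem abs_im_mul_exp_of_pow_four {r : ℂ} (hr : r ^ 4 = 1) :
    (∀ t : ℝ, |(r * Complex.exp (I * t)).im| = |Real.sin t|) ∨
      ∀ t : ℝ, |(r * Complex.exp (I * t)).im| = |Real.cos t| := by
  have hcases : (r - 1) * (r + 1) * ((r - I) * (r + I)) = 0 := by
    linear_combination hr - (r ^ 2 - 1) * I_sq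
  have hs (t : ℝ) : (Complex.exp (I * t)).im = Real.sin t := by
    rw [mul_comm, Complex.exp_ofReal_mul_I_im]
  have hc (t : ℝ) : (Complex.exp (I * t)).re = Real.cos t := by
    rw [mul_comm, Complex.exp_ofReal_mul_I_re]
  simp only [mul_eq_zero, sub_eq_zero, ← eq_neg_iff_add_eq_zero] at hcases
  rcases hcases with (rfl | rfl) | (rfl | rfl)
  · exact .inl fun t => by rw [one_mul, hs]
  · exact .inl fun t => by rw [neg_one_mul, neg_im, abs_neg, hs]
  · exact .inr fun t => by rw [I_mul_im, hc]
  · exact .inr fun t => by rw [neg_mul, neg_im, abs_neg, I_mul_im, hc]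

theorem theorem1 (U : TwoQubitOp)
    (hU : U ∈ Matrix.specialUnitaryGroup (Fin 2 × Fin 2) ℂ)
    (θ : ℝ) (hθ : 0 ≤ θ) (N : ℕ) (hcirc : DaCircuit θ N U)
    (hN : (N : ℝ) * θ < Real.pi / 4)
    (kx ky kz : ℝ) (hk : IsCartanCoordinate U kx ky kz) :
    Real.sin (|kx| + |ky| + |kz|) ≤ Real.sin ((N : ℝ) * θ) ∧
      |kx| + |ky| + |kz| ≤ (N : ℝ) * θ := by
  have hπ := Real.pi_pos
  have hNθ : 0 ≤ (N : ℝ) * θ := by positivity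
  obtain ⟨hz, hyx, hx, -, k, hk, a, ha, b, hb, c, hc, d, hd, hUk⟩ := hk
  obtain ⟨p, V, hV, hUV, hbound⟩ := hcirc.exists_specialUnitary hθ
  have hy0 : 0 ≤ ky := (abs_nonneg kz).trans hz
  have hx0 : 0 ≤ kx := hy0.trans hyx
  have hdU := (mem_specialUnitaryGroup_iff.1 hU).2
  have hp : p ^ 4 = 1 := by
    have h := hdU
    rw [hUV, det_smul, (mem_specialUnitaryGroup_iff.1 hV).2] at h
    simpa using h
  have hk4 : k ^ 4 = 1 := by
    rcases hk with rfl | rfl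
    · simp
    · exact I_pow_four
  have hp0 : p ≠ 0 := by
    rintro rfl
    simp at hp
  have hVk : V = (p⁻¹ * k) • ((a ⊗ₖ b) * canonicalGate kx ky kz * (c ⊗ₖ d)) := by
    rw [mul_smul, ← hUk, hUV, inv_smul_smul₀ hp0]
  have hr : (p⁻¹ * k) ^ 4 = 1 := by rw [mul_pow, inv_pow, hp, hk4, inv_one, one_mul]
  have key := abs_im_mul_exp_bellAngle_le ha hb hc hd hVk (hbound (by linarith))
  have hsinN : Real.sin (N * θ) < Real.sin (Real.pi / 4) :=
    Real.sin_lt_sin_of_lt_of_le_pi_div_two (by linarith) (by linarith) hN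
  have hle := le_abs_self kz
  have hle' := neg_abs_le kz
  have hzn := abs_nonneg kz
  rcases abs_im_mul_exp_of_pow_four hr with hsin | hcos
  · have hkt : Real.sin (|kx| + |ky| + |kz|) ≤ Real.sin (N * θ) := by
      rw [abs_of_nonneg hx0, abs_of_nonneg hy0]
      -- The sign of kz decides which Bell state has exponent ±k_t.
      rcases le_total 0 kz with h0 | h0
      · have h := key (1, 1)
        rw [hsin] at h
        have he : bellAngle kx ky kz (1, 1) = -(kx + ky + kz) := by
          simp [bellAngle]
          ring
        rw [he, Real.sin_neg, abs_neg] at h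
        rw [abs_of_nonneg h0]
        exact (le_abs_self _).trans h
      · have h := key (0, 1)
        rw [hsin] at h
        have he : bellAngle kx ky kz (0, 1) = kx + ky + -kz := by
          simp [bellAngle]
        rw [he] at h
        rw [abs_of_nonpos h0]
        exact (le_abs_self _).trans h
    refine ⟨hkt, ?_⟩
    have h3 : |kx| + |ky| + |kz| ≤ 3 * (Real.pi / 4) := by
      rw [abs_of_nonneg hx0, abs_of_nonneg hy0]
      linarith
    have h0 : 0 ≤ |kx| + |ky| + |kz| := by positivity
    by_contra! hlt
    -- Sine is not monotone up to 3π/4, but on [π/2, 3π/4] it is at least sin(π/4) > sin(Nθ).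
    rcases le_total (|kx| + |ky| + |kz|) (Real.pi / 2) with h2 | h2
    · exact absurd hkt (not_le.2 (Real.sin_lt_sin_of_lt_of_le_pi_div_two (by linarith) h2 hlt))
    · have h := Real.sin_le_sin_of_le_of_le_pi_div_two (x := Real.pi / 4)
        (y := Real.pi - (|kx| + |ky| + |kz|)) (by linarith) (by linarith) (by linarith)
      rw [Real.sin_pi_sub] at h
      linarith
  · exfalso
    -- The chamber puts this exponent in [-π/4, π/4], where the cosine exceeds sin(Nθ).
    have h := key (0, 0)
    rw [hcos] at h
    have he : bellAngle kx ky kz (0, 0) = kx - ky + kz := by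
      simp [bellAngle]
      ring
    rw [he] at h
    have habs : |kx - ky + kz| ≤ Real.pi / 4 := abs_le.2 ⟨by linarith, by linarith⟩
    have hcos' : Real.cos (Real.pi / 4) ≤ Real.cos (kx - ky + kz) := by
      rw [← Real.cos_abs (kx - ky + kz)]
      exact Real.cos_le_cos_of_nonneg_of_le_pi (abs_nonneg _) (by linarith) habs
    rw [Real.cos_pi_div_four, ← Real.sin_pi_div_four] at hcos'
    linarith [le_abs_self (Real.cos (kx - ky + kz))]
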